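/- **Definitions.** All categories are finitely complete. For a map $f:X\to Y$, $R[f]$ denotes its kernel equivalence relation, with projections $d_0^f,d_1^f:R[f]\to X$ and diagonal $s_0^f:X\to R[f]$. All statements "with elements" are about generalized elements. * A category $\mathbb E$ is a *Gumm category* if the Shifting Lemma holds in it: for all internal equivalence relations $T,S,R$ on an object with $R\cap S\subset T$, if $x\,S\,y$, $x'\,S\,y'$, $x\,R\,x'$, $y\,R\,y'$ and $x\,T\,x'$, then $y\,T\,y'$. It is *regular* if kernel equivalence relations have coequalizers and regular epimorphisms are stable under pullback. * $Pt_Y\mathbb E$ is the pointed category whose objects are the split epimorphisms $(f,s):X\rightleftarrows Y$ (that is, $f s=1_Y$) and whose maps are the maps $X\to X'$ commuting with the epimorphisms and with the sections. * For equivalence relations $R,S$ on $X$, $R\square S$ is the object of quadruples $(x,y,t,z)$ with $xRy$, $tRz$, $xSt$, $ySz$; $R\times_1S$ is the object of triples $(x,y,z)$ with $xRySz$; and $\zeta_{R,S}:R\square S\to R\times_1S$ sends $(x,y,t,z)$ to $(x,y,z)$. A relation $(\pi_0,\pi_1):W\rightarrowtail X\times Z$ is *difunctional* if $R[\pi_0]\cap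 R[\pi_1]$ is the diagonal $\Delta_W$ and $\zeta_{R[\pi_0],R[\pi_1]}$ is an isomorphism. In a pointed category it is *right punctual* if $\pi_1$ has a section $t$ with $\pi_0t=0$. * A pointed category satisfies *Axiom $\ast$* if, for every right punctual difunctional relation $(\pi_0,\pi_1):W\rightarrowtail X\times Z$ and every equivalence relation $T$ on $W$, the map $\zeta_{R[\pi_0],T}$ is an extremal epimorphism. * The *diagonal punctuation* of an object $X$ of a pointed category is, when it exists, the pushout $\omega_X:X\times X\to Dp\,X$ of the diagonal $X\to X\times X$ along $X\to 1=0$. A pointed category *admits diagonal punctuations* if every object has one. * An object $X$ of a pointed category is *abelian* if it carries an internal subtraction $d:X\times X\to X$, i.e. $d(x,x)=0$ and $d(x,0)=x$. An *abelian split epimorphism above $Y$* is an abelian object of $Pt_Y\mathbb E$. **Theorem.** Let $\mathbb E$ be a regular Gumm category such that every fibre $Pt_Y\mathbb E$ satisfies Axiom $\ast$ and admits diagonal punctuations. 1. Let $(f,s):X\rightleftarrows Y$ be any split epimorphism, and let $\omega_f$ be its diagonal punctuation in $Pt_Y\mathbb E$, with values in the split epimorphism $(\psi_f,\theta_f):Dp[f]\rightleftarrows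 Y$. The product of $(f,s)$ with itself in $Pt_Y\mathbb E$ is $R[f]$, and the square $$\begin{array}{ccc} R[f] & \xrightarrow{\ \omega_f\ } & Dp[f]\\ {\scriptstyle s_0^f}\uparrow & & \uparrow{\scriptstyle \theta_f}\\ X & \xrightarrow{\ f\ } & Y\end{array}$$ is a pushout in $\mathbb E$ with $\omega_f$ a regular epimorphism. Moreover $(\psi_f,\theta_f)$ is the universal abelian split epimorphism associated with $(f,s)$: it is abelian, and every map of $Pt_Y\mathbb E$ from $(f,s)$ to an abelian split epimorphism $(g,t)$ above $Y$ factors, by a unique map $(\psi_f,\theta_f)\to(g,t)$ of $Pt_Y\mathbb E$, through the comparison $\omega_f\circ(sf,1_X):(f,s)\to(\psi_f,\theta_f)$. 2. For every object $Y$, the abelian split epimorphisms above $Y$ are stable under monomorphisms in $Pt_Y\mathbb E$: if $U\rightarrowtail A$ is a monomorphism of $Pt_Y\mathbb E$ and $A$ is abelian, then $U$ is abelian. -/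

import Mathlib

open CategoryTheory CategoryTheory.Limits

namespace GummCat

universe v u

section Relations

/-- For a pair of parallel maps `d₀ d₁ : R ⟶ X` (a relation on `X`), the generalized elements
`x y : A ⟶ X` are related: `x R y`. -/
def Rel {C : Type u} [Category.{v} C] {R X A : C} (d₀ d₁ : R ⟶ X) (x y : A ⟶ X) : Prop :=
  ∃ r : A ⟶ R, r ≫ d₀ = x ∧ r ≫ d₁ = y

/-- A Gumm category: the Shifting Lemma holds for all triples `(T, S, R)` of internal equivalence
relations on an object `X` with `R ∩ S ⊆ T` (expressed with generalized elements): if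
`x S y`, `x' S y'`, `x R x'`, `y R y'` and `x T x'`, then `y T y'`. -/
def IsGumm (C : Type u) [Category.{v} C] : Prop :=
  ∀ ⦃X R S T : C⦄ (r₀ r₁ : R ⟶ X) (s₀ s₁ : S ⟶ X) (t₀ t₁ : T ⟶ X),
    IsEquivalenceRelation r₀ r₁ → IsEquivalenceRelation s₀ s₁ → IsEquivalenceRelation t₀ t₁ →
    (∀ ⦃A : C⦄ (x y : A ⟶ X), Rel r₀ r₁ x y → Rel s₀ s₁ x y → Rel t₀ t₁ x y) →
    ∀ ⦃A : C⦄ (x y x' y' : A ⟶ X),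
      Rel s₀ s₁ x y → Rel s₀ s₁ x' y' → Rel r₀ r₁ x x' → Rel r₀ r₁ y y' →
      Rel t₀ t₁ x x' → Rel t₀ t₁ y y'

/-- `Q` is the square construction `R □ S` of two relations on `X`, i.e. the inverse image of
`S × S` along `(r₀, r₁) : R ⟶ X × X`. A generalized element of `Q` is a quadruple `(x, y, t, z)`
with `x R y` (given by `a`), `t R z` (given by `a'`), `x S t` (given by `b`) and `y S z`
(given by `b'`). -/
structure IsSquareObj {C : Type u} [Category.{v} C] {X R S Q : C}
    (r₀ r₁ : R ⟶ X) (s₀ s₁ : S ⟶ X) (a a' : Q ⟶ R) (b b' : Q ⟶ S) : Prop where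
  eq_x : a ≫ r₀ = b ≫ s₀
  eq_y : a ≫ r₁ = b' ≫ s₀
  eq_t : a' ≫ r₀ = b ≫ s₁
  eq_z : a' ≫ r₁ = b' ≫ s₁
  existsUnique_lift : ∀ ⦃A : C⦄ (u u' : A ⟶ R) (w w' : A ⟶ S),
    u ≫ r₀ = w ≫ s₀ → u ≫ r₁ = w' ≫ s₀ → u' ≫ r₀ = w ≫ s₁ → u' ≫ r₁ = w' ≫ s₁ →
    ∃! q : A ⟶ Q, q ≫ a = u ∧ q ≫ a' = u' ∧ q ≫ b = w ∧ q ≫ b' = w'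

/-- The forgetful factorization `ζ_{R,S} : R □ S ⟶ R ×₁ S`, `(x, y, t, z) ↦ (x R y S z)`, where
`P = R ×₁ S` is the pullback of `r₁` and `s₀`. -/
noncomputable def zeta {C : Type u} [Category.{v} C] {X R S Q P : C}
    {r₀ r₁ : R ⟶ X} {s₀ s₁ : S ⟶ X} {a a' : Q ⟶ R} {b b' : Q ⟶ S} {p : P ⟶ R} {q : P ⟶ S}
    (hQ : IsSquareObj r₀ r₁ s₀ s₁ a a' b b') (hP : IsPullback p q r₁ s₀) : Q ⟶ P :=
  hP.lift a b' hQ.eq_y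

/-- Sharp intersection of two equivalence relations `R` and `S` on `X`: `R ∩ S` is the diagonal
and `ζ_{R,S}` is an isomorphism. -/
def IsSharp {C : Type u} [Category.{v} C] {X R S : C}
    (r₀ r₁ : R ⟶ X) (s₀ s₁ : S ⟶ X) : Prop :=
  (∀ ⦃A : C⦄ (x y : A ⟶ X), Rel r₀ r₁ x y → Rel s₀ s₁ x y → x = y) ∧
  ∀ ⦃Q P : C⦄ (a a' : Q ⟶ R) (b b' : Q ⟶ S) (p : P ⟶ R) (q : P ⟶ S)
    (hQ : IsSquareObj r₀ r₁ s₀ s₁ a a' b b') (hP : IsPullback p q r₁ s₀), IsIso (zeta hQ hP)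

/-- The relation `(f, g) : W ⟶ X × Z` is difunctional: the kernel equivalence relations
`R[f]` and `R[g]` have a sharp intersection. -/
def IsDifunctional {C : Type u} [Category.{v} C] {W X Z : C} (f : W ⟶ X) (g : W ⟶ Z) : Prop :=
  ∀ ⦃K L : C⦄ (k₀ k₁ : K ⟶ W) (l₀ l₁ : L ⟶ W),
    IsKernelPair f k₀ k₁ → IsKernelPair g l₀ l₁ → IsSharp k₀ k₁ l₀ l₁

end Relations

section Pointed

/-- A span `(f, g)` in a pointed category is right punctual when `g` has a section `t`
with `f.t = 0`. -/
def IsRightPunctual {D : Type u} [Category.{v} D] [HasZeroMorphisms D] {W X Z : D}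
    (f : W ⟶ X) (g : W ⟶ Z) : Prop :=
  ∃ t : Z ⟶ W, t ≫ g = 𝟙 Z ∧ t ≫ f = 0

/-- Axiom `∗` for a (finitely complete) pointed category: for any right punctual difunctional
relation `W` between `X` and `Z`, and any equivalence relation `T` on `W`, the factorization
`ζ_{R[π₀],T} : R[π₀] □ T ⟶ R[π₀] ×₁ T` is an extremal epimorphism. -/
def AxiomStar (D : Type u) [Category.{v} D] [HasZeroMorphisms D] : Prop :=
  ∀ ⦃X Z W T K : D⦄ (π₀ : W ⟶ X) (π₁ : W ⟶ Z) (t₀ t₁ : T ⟶ W) (k₀ k₁ : K ⟶ W),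
    JointlyMono₂ π₀ π₁ → IsRightPunctual π₀ π₁ → IsDifunctional π₀ π₁ →
    IsEquivalenceRelation t₀ t₁ → IsKernelPair π₀ k₀ k₁ →
    ∀ ⦃Q P : D⦄ (a a' : Q ⟶ K) (b b' : Q ⟶ T) (p : P ⟶ K) (q : P ⟶ T)
      (hQ : IsSquareObj k₀ k₁ t₀ t₁ a a' b b') (hP : IsPullback p q k₁ t₀),
      ExtremalEpi (zeta hQ hP)

open scoped ZeroObject in
/-- `ω : X × X ⟶ Dp` exhibits `Dp` as the diagonal punctuation of `X`: the pushout of the diagonal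
`s₀ : X ⟶ X × X` along the terminal map `X ⟶ 1` (in a pointed category, `1 = 0`). -/
structure IsDiagonalPunctuation {D : Type u} [Category.{v} D] [HasZeroObject D]
    [HasZeroMorphisms D] {X XX Dp : D}
    (p₀ p₁ : XX ⟶ X) (s₀ : X ⟶ XX) (ω : XX ⟶ Dp) : Prop where
  isProduct : Nonempty (IsLimit (BinaryFan.mk p₀ p₁))
  s₀_p₀ : s₀ ≫ p₀ = 𝟙 X
  s₀_p₁ : s₀ ≫ p₁ = 𝟙 X
  isPushout : IsPushout s₀ (0 : X ⟶ (0 : D)) ω (0 : (0 : D) ⟶ Dp)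

/-- Every object has a diagonal punctuation. -/
def HasDiagonalPunctuations (D : Type u) [Category.{v} D] [HasZeroObject D]
    [HasZeroMorphisms D] : Prop :=
  ∀ X : D, ∃ (XX Dp : D) (p₀ p₁ : XX ⟶ X) (s₀ : X ⟶ XX) (ω : XX ⟶ Dp),
    IsDiagonalPunctuation p₀ p₁ s₀ ω

/-- An internal subtraction on `X`: a binary operation `d : X × X ⟶ X` with `d(x, x) = 0` and
`d(x, 0) = x` (the generalized element `u = (x, y)` of `X × X` has components
`u ≫ p₀` and `u ≫ p₁`). -/
structure Subtraction {D : Type u} [Category.{v} D] [HasZeroMorphisms D] (X : D) where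
  XX : D
  p₀ : XX ⟶ X
  p₁ : XX ⟶ X
  isProduct : IsLimit (BinaryFan.mk p₀ p₁)
  d : XX ⟶ X
  d_self : ∀ ⦃A : D⦄ (u : A ⟶ XX), u ≫ p₀ = u ≫ p₁ → u ≫ d = 0
  d_zero : ∀ ⦃A : D⦄ (u : A ⟶ XX), u ≫ p₁ = 0 → u ≫ d = u ≫ p₀

/-- An object of a pointed category is abelian when it carries a subtraction. -/
def IsAbelian {D : Type u} [Category.{v} D] [HasZeroMorphisms D] (X : D) : Prop :=
  Nonempty (Subtraction X)

/-- `η : X ⟶ U` is the universal comparison of `X` with the abelian objects: `U` is a reflection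
of `X` in the full subcategory of abelian objects. -/
structure IsUniversalAbelian {D : Type u} [Category.{v} D] [HasZeroMorphisms D] {X U : D}
    (η : X ⟶ U) : Prop where
  isAbelian : IsAbelian U
  existsUnique_desc : ∀ ⦃A : D⦄, IsAbelian A → ∀ h : X ⟶ A, ∃! k : U ⟶ A, η ≫ k = h

end Pointed

section Points

/-- Objects of the fibre `Pt_Y C`: split epimorphisms above `Y` with a given splitting. -/
structure Pt {C : Type u} [Category.{v} C] (Y : C) where
  obj : C
  π : obj ⟶ Y
  σ : Y ⟶ obj
  σ_π : σ ≫ π = 𝟙 Y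

/-- Morphisms of the fibre `Pt_Y C`. -/
@[ext]
structure Pt.Hom {C : Type u} [Category.{v} C] {Y : C} (P Q : Pt Y) where
  hom : P.obj ⟶ Q.obj
  hom_π : hom ≫ Q.π = P.π
  σ_hom : P.σ ≫ hom = Q.σ

instance Pt.category {C : Type u} [Category.{v} C] (Y : C) : Category.{v} (Pt Y) where
  Hom P Q := Pt.Hom P Q
  id P := ⟨𝟙 P.obj, Category.id_comp _, Category.comp_id _⟩
  comp f g := ⟨f.hom ≫ g.hom, by rw [Category.assoc, g.hom_π, f.hom_π],
    by rw [← Category.assoc, f.σ_hom, g.σ_hom]⟩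
  id_comp f := Pt.Hom.ext (Category.id_comp f.hom)
  comp_id f := Pt.Hom.ext (Category.comp_id f.hom)
  assoc f g h := Pt.Hom.ext (Category.assoc f.hom g.hom h.hom)

instance Pt.hasZeroMorphisms {C : Type u} [Category.{v} C] (Y : C) :
    HasZeroMorphisms (Pt Y) where
  zero P Q := ⟨⟨P.π ≫ Q.σ, by rw [Category.assoc, Q.σ_π, Category.comp_id],
    by rw [← Category.assoc, P.σ_π, Category.id_comp]⟩⟩
  comp_zero {P Q} f R := Pt.Hom.ext (by
    change f.hom ≫ Q.π ≫ R.σ = P.π ≫ R.σ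
    rw [← Category.assoc, f.hom_π])
  zero_comp P {Q R} g := Pt.Hom.ext (by
    change (P.π ≫ Q.σ) ≫ g.hom = P.π ≫ R.σ
    rw [Category.assoc, g.σ_hom])

/-- The zero object `(1_Y, 1_Y)` of `Pt_Y C`. -/
def Pt.zeroObj {C : Type u} [Category.{v} C] (Y : C) : Pt Y :=
  ⟨Y, 𝟙 Y, 𝟙 Y, Category.comp_id _⟩

instance Pt.hasZeroObject {C : Type u} [Category.{v} C] (Y : C) : HasZeroObject (Pt Y) :=
  ⟨⟨Pt.zeroObj Y, (IsZero.iff_id_eq_zero _).2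
    (Pt.Hom.ext (Category.comp_id (𝟙 Y)).symm)⟩⟩

end Points

end GummCat

namespace GummCat

universe v u

/-! ### Binary products through generalized elements -/

section Products

variable {D : Type u} [Category.{v} D] {X Y XY : D} {p₀ : XY ⟶ X} {p₁ : XY ⟶ Y}

/-! Two principles about a map `φ` on a product in the fibre carry the proof. By the Shifting Lemma
(`Pt.shift`), `φ(a, b) = φ(a', b)` implies `φ(a, c) = φ(a', c)`. By Axiom `∗`
(`AxiomStar.exists_cover`), if `φ` kills the diagonal of `X × X`, the triple `(x, y), (y, y), (0,
0)` is completed, locally, by some `(w, 0)` with `φ(w, 0) = φ(x, y)`.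

For `φ = ω`, Axiom `∗` makes `η : x ↦ ω(x, 0)` a regular epimorphism on domains, while shifting
shows that `ω(x, y)` depends only on `η x` and `η y`. Hence `ω` descends along `η × η` to a
subtraction on `Dp`. An abelian `A` receives the map induced by `(x, y) ↦ d(h y, h x)`; uniqueness
follows by shifting the subtraction of two candidates.

For a subobject `U` of an abelian `A`, take for `φ` the subtraction restricted to `U × U`. Shifting
makes `φ` injective in its first variable, so the cover in Axiom `∗` is an isomorphism and `w`
exists globally: it is the difference of `x` and `y` in `U`. -/

theorem exists_lift_of_isLimit (h : IsLimit (BinaryFan.mk p₀ p₁)) {A : D} (x : A ⟶ X)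
    (y : A ⟶ Y) : ∃ l : A ⟶ XY, l ≫ p₀ = x ∧ l ≫ p₁ = y :=
  ⟨_, (BinaryFan.IsLimit.lift' h x y).2.1, (BinaryFan.IsLimit.lift' h x y).2.2⟩

theorem hom_ext_of_isLimit (h : IsLimit (BinaryFan.mk p₀ p₁)) {A : D} {x y : A ⟶ XY}
    (h₀ : x ≫ p₀ = y ≫ p₀) (h₁ : x ≫ p₁ = y ≫ p₁) : x = y :=
  BinaryFan.IsLimit.hom_ext h h₀ h₁

end Products

/-! ### The Shifting Lemma for kernel relations -/

section Shifting

variable {C : Type u} [Category.{v} C] 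

theorem isEquivalenceRelation_of_isKernelPair [HasPullbacks C] {X Y R : C} {f : X ⟶ Y} {r₀ r₁ : R ⟶ X}
    (h : IsKernelPair f r₀ r₁) : IsEquivalenceRelation r₀ r₁ :=
  (IsKernelPair.equivalenceRelation f r₀ r₁ (pullbackIsPullback r₁ r₀) h).isEquivalenceRelation

theorem rel_iff_of_isKernelPair {X Y R : C} {f : X ⟶ Y} {r₀ r₁ : R ⟶ X}
    (h : IsKernelPair f r₀ r₁) {A : C} (x y : A ⟶ X) : Rel r₀ r₁ x y ↔ x ≫ f = y ≫ f := by
  constructor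
  · rintro ⟨r, rfl, rfl⟩
    simp [h.w]
  · intro e
    exact ⟨h.lift x y e, h.lift_fst _ _ _, h.lift_snd _ _ _⟩

/-- The Shifting Lemma for the kernel equivalence relations of three maps `f`, `g`, `h`. -/
theorem IsGumm.shift [HasPullbacks C] (hG : IsGumm C) {W X Y Z : C} (f : W ⟶ X) (g : W ⟶ Y) (h : W ⟶ Z)
    (hfg : ∀ ⦃A : C⦄ (x y : A ⟶ W), x ≫ f = y ≫ f → x ≫ g = y ≫ g → x ≫ h = y ≫ h)
    {A : C} {x y x' y' : A ⟶ W} (hx : x ≫ g = y ≫ g) (hx' : x' ≫ g = y' ≫ g)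
    (hf : x ≫ f = x' ≫ f) (hf' : y ≫ f = y' ≫ f) (hh : x ≫ h = x' ≫ h) :
    y ≫ h = y' ≫ h := by
  have kf := IsKernelPair.of_hasPullback f
  have kg := IsKernelPair.of_hasPullback g
  have kh := IsKernelPair.of_hasPullback h
  have key := hG _ _ _ _ _ _ (isEquivalenceRelation_of_isKernelPair kf)
    (isEquivalenceRelation_of_isKernelPair kg) (isEquivalenceRelation_of_isKernelPair kh)
  simp only [rel_iff_of_isKernelPair kf, rel_iff_of_isKernelPair kg,
    rel_iff_of_isKernelPair kh] at key
  exact key hfg x y x' y' hx hx' hf hf' hh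

end Shifting

/-! ### Finite limits and shifting in the fibres -/

namespace Pt

variable {C : Type u} [Category.{v} C] {Y : C}

@[simp] theorem comp_hom {P Q R : Pt Y} (f : P ⟶ Q) (g : Q ⟶ R) :
    (f ≫ g).hom = f.hom ≫ g.hom := rfl

attribute [simp] σ_π

@[simp] theorem hom_π {P Q : Pt Y} (f : P ⟶ Q) : f.hom ≫ Q.π = P.π := Hom.hom_π f

@[simp] theorem σ_hom {P Q : Pt Y} (f : P ⟶ Q) : P.σ ≫ f.hom = Q.σ := Hom.σ_hom f

@[simp] theorem σ_π_assoc (P : Pt Y) {Z : C} (h : Y ⟶ Z) : P.σ ≫ P.π ≫ h = h := by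
  rw [← Category.assoc, P.σ_π, Category.id_comp]

@[simp] theorem σ_hom_assoc {P Q : Pt Y} (f : P ⟶ Q) {Z : C} (h : Q.obj ⟶ Z) :
    P.σ ≫ f.hom ≫ h = Q.σ ≫ h := by
  rw [← Category.assoc, σ_hom]

theorem hom_ext {P Q : Pt Y} {f g : P ⟶ Q} (h : f.hom = g.hom) : f = g := Hom.ext h

theorem mono_of_mono_hom {P Q : Pt Y} (f : P ⟶ Q) [Mono f.hom] : Mono f :=
  ⟨fun _ _ e => hom_ext ((cancel_mono f.hom).1 (congrArg Hom.hom e))⟩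

theorem isIso_hom {P Q : Pt Y} (f : P ⟶ Q) [IsIso f] : IsIso f.hom :=
  ⟨(inv f).hom, congrArg Hom.hom (IsIso.hom_inv_id f), congrArg Hom.hom (IsIso.inv_hom_id f)⟩

/-- The pullback of pointed split epimorphisms, computed on the domains. -/
theorem exists_isPullback [HasPullbacks C] {P Q R : Pt Y} (f : P ⟶ R) (g : Q ⟶ R) :
    ∃ (S : Pt Y) (a : S ⟶ P) (b : S ⟶ Q), IsPullback a b f g ∧
      IsPullback a.hom b.hom f.hom g.hom := by
  have hσ : P.σ ≫ f.hom = Q.σ ≫ g.hom := by rw [σ_hom, σ_hom]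
  have hw := pullback.condition (f := f.hom) (g := g.hom)
  let S : Pt Y := ⟨pullback f.hom g.hom, pullback.fst f.hom g.hom ≫ P.π,
    pullback.lift P.σ Q.σ hσ, by rw [pullback.lift_fst_assoc, P.σ_π]⟩
  let a : S ⟶ P := ⟨pullback.fst f.hom g.hom, rfl, pullback.lift_fst _ _ _⟩
  let b : S ⟶ Q := ⟨pullback.snd f.hom g.hom, by
    change pullback.snd f.hom g.hom ≫ Q.π = pullback.fst f.hom g.hom ≫ P.π
    rw [← hom_π g, ← hom_π f, pullback.condition_assoc], pullback.lift_snd _ _ _⟩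
  have hS := IsPullback.of_hasPullback f.hom g.hom
  refine ⟨S, a, b, ⟨⟨hom_ext hw⟩, ⟨PullbackCone.IsLimit.mk _
    (fun s => ⟨hS.lift s.fst.hom s.snd.hom (congrArg Hom.hom s.condition), ?_, ?_⟩)
    ?_ ?_ ?_⟩⟩, hS⟩
  · change hS.lift _ _ _ ≫ pullback.fst f.hom g.hom ≫ P.π = _
    rw [hS.lift_fst_assoc, hom_π]
  · refine hS.hom_ext ?_ ?_
    · rw [Category.assoc, hS.lift_fst, σ_hom]
      exact (pullback.lift_fst _ _ _).symm
    · rw [Category.assoc, hS.lift_snd, σ_hom]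
      exact (pullback.lift_snd _ _ _).symm
  · intro s
    exact hom_ext (hS.lift_fst _ _ _)
  · intro s
    exact hom_ext (hS.lift_snd _ _ _)
  · intro s m h₀ h₁
    refine hom_ext (hS.hom_ext ?_ ?_)
    · exact (congrArg Hom.hom h₀).trans (hS.lift_fst _ _ _).symm
    · exact (congrArg Hom.hom h₁).trans (hS.lift_snd _ _ _).symm

instance [HasPullbacks C] : HasPullbacks (Pt Y) :=
  have (P Q R : Pt Y) (f : P ⟶ R) (g : Q ⟶ R) : HasLimit (cospan f g) := by
    obtain ⟨S, a, b, h, -⟩ := exists_isPullback f g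
    exact h.hasPullback
  hasPullbacks_of_hasLimit_cospan _

instance [HasPullbacks C] : HasFiniteLimits (Pt Y) :=
  have : HasTerminal (Pt Y) := HasZeroObject.hasTerminal
  hasFiniteLimits_of_hasTerminal_and_pullbacks

theorem isPullback_hom [HasPullbacks C] {P Q R S : Pt Y} {a : S ⟶ P} {b : S ⟶ Q} {f : P ⟶ R}
    {g : Q ⟶ R} (h : IsPullback a b f g) : IsPullback a.hom b.hom f.hom g.hom := by
  obtain ⟨S', a', b', h₁, h₂⟩ := exists_isPullback f g
  let e := h.isoIsPullback _ _ h₁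
  have : IsIso e.hom.hom := isIso_hom e.hom
  refine IsPullback.of_iso h₂ (asIso e.hom.hom).symm (Iso.refl _) (Iso.refl _) (Iso.refl _)
    ?_ ?_ ?_ ?_
  · simp only [Iso.symm_hom, asIso_inv, Iso.refl_hom, Category.comp_id]
    rw [eq_comm, IsIso.inv_comp_eq]
    exact (congrArg Hom.hom (h.isoIsPullback_hom_fst _ _ h₁)).symm
  · simp only [Iso.symm_hom, asIso_inv, Iso.refl_hom, Category.comp_id]
    rw [eq_comm, IsIso.inv_comp_eq]
    exact (congrArg Hom.hom (h.isoIsPullback_hom_snd _ _ h₁)).symm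
  · simp
  · simp

/-- A product is a pullback over the zero object, whose domain is `Y`; the square of `(f, s)` is
therefore `R[f]`. -/
theorem isPullback_of_isLimit_binaryFan [HasPullbacks C] {P Q S : Pt Y} {a : S ⟶ P} {b : S ⟶ Q}
    (h : IsLimit (BinaryFan.mk a b)) : IsPullback a.hom b.hom P.π Q.π := by
  have hz : IsTerminal (zeroObj Y) := ((IsZero.iff_id_eq_zero (zeroObj Y)).2
    (Hom.ext (Category.comp_id (𝟙 Y)).symm)).isTerminal
  have key := isPullback_hom (IsPullback.of_isLimit_binaryFan_of_isTerminal h hz)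
  have e : ∀ R : Pt Y, (hz.from R).hom = R.π := fun R => by
    simpa [zeroObj] using hom_π (hz.from R)
  rw [e, e] at key
  exact key

/-- The kernel relations of the two projections meet in the diagonal, so the inclusion required by
the Shifting Lemma holds for every `h`. -/
theorem shift [HasPullbacks C] (hG : IsGumm C) {P Q S V : Pt Y} {p₀ : S ⟶ P} {p₁ : S ⟶ Q}
    (hp : IsLimit (BinaryFan.mk p₀ p₁)) (h : S ⟶ V) {A : C} {x y x' y' : A ⟶ S.obj}
    (hx : x ≫ p₀.hom = y ≫ p₀.hom) (hx' : x' ≫ p₀.hom = y' ≫ p₀.hom)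
    (hy : x ≫ p₁.hom = x' ≫ p₁.hom) (hy' : y ≫ p₁.hom = y' ≫ p₁.hom)
    (hh : x ≫ h.hom = x' ≫ h.hom) : y ≫ h.hom = y' ≫ h.hom :=
  hG.shift p₁.hom p₀.hom h.hom
    (fun _ _ _ h₁ h₀ => by rw [(isPullback_of_isLimit_binaryFan hp).hom_ext h₀ h₁])
    hx hx' hy hy' hh

end Pt

/-! ### Axiom `∗` for products -/

section Star

variable {D : Type u} [Category.{v} D]

theorem exists_isSquareObj [HasFiniteLimits D] {X R S : D} (r₀ r₁ : R ⟶ X) (s₀ s₁ : S ⟶ X) :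
    ∃ (Q : D) (a a' : Q ⟶ R) (b b' : Q ⟶ S), IsSquareObj r₀ r₁ s₀ s₁ a a' b b' := by
  have h₁ := IsPullback.of_hasPullback r₁ s₀
  have h₂ := IsPullback.of_hasPullback s₁ r₀
  set c := pullback.fst r₁ s₀
  set c' := pullback.snd r₁ s₀
  set e := pullback.fst s₁ r₀
  set e' := pullback.snd s₁ r₀
  have hp := prodIsProd X X
  obtain ⟨f, hf₀, hf₁⟩ := exists_lift_of_isLimit hp (c ≫ r₀) (c' ≫ s₁)
  obtain ⟨g, hg₀, hg₁⟩ := exists_lift_of_isLimit hp (e ≫ s₀) (e' ≫ r₁)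
  have h := IsPullback.of_hasPullback f g
  set l := pullback.fst f g
  set m := pullback.snd f g
  refine ⟨pullback f g, l ≫ c, m ≫ e', m ≫ e, l ≫ c', ?_, ?_, ?_, ?_, ?_⟩
  · simp only [Category.assoc, ← hf₀, ← hg₀, h.w_assoc]
  · simp only [Category.assoc, h₁.w]
  · simp only [Category.assoc, h₂.w]
  · simp only [Category.assoc, ← hf₁, ← hg₁, h.w_assoc]
  · intro A u u' w w' e₁ e₂ e₃ e₄
    have key : h₁.lift u w' e₂ ≫ f = h₂.lift w u' e₃.symm ≫ g := by
      apply hom_ext_of_isLimit hp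
      · simp [hf₀, hg₀, e₁]
      · simp [hf₁, hg₁, e₄]
    refine ⟨h.lift _ _ key, by simp, ?_⟩
    rintro q ⟨rfl, rfl, rfl, rfl⟩
    refine h.hom_ext (h₁.hom_ext ?_ ?_) (h₂.hom_ext ?_ ?_) <;> simp

theorem isDifunctional_of_isLimit {X Y W : D} {p₀ : W ⟶ X} {p₁ : W ⟶ Y}
    (hp : IsLimit (BinaryFan.mk p₀ p₁)) : IsDifunctional p₁ p₀ := by
  intro K L k₀ k₁ l₀ l₁ hK hL
  refine ⟨?_, ?_⟩
  · rintro A x y ⟨r, rfl, rfl⟩ ⟨s, h₀, h₁⟩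
    refine hom_ext_of_isLimit hp ?_ (by simp [hK.w])
    rw [← h₀, ← h₁, Category.assoc, Category.assoc, hL.w]
  · intro Q P a a' b b' p q hQ hP
    -- The missing corner of the rectangle: first coordinate of `x`, second coordinate of `z`.
    obtain ⟨t, ht₀, ht₁⟩ := exists_lift_of_isLimit hp (p ≫ k₀ ≫ p₀) (q ≫ l₁ ≫ p₁)
    obtain ⟨c, ⟨hca, -, -, hcb'⟩, -⟩ := hQ.existsUnique_lift p
      (hK.lift t (q ≫ l₁) (by simpa using ht₁)) (hL.lift (p ≫ k₀) t (by simpa using ht₀.symm)) q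
      (by simp) hP.w (by simp) (by simp)
    have hz : zeta hQ hP ≫ p = a := hP.lift_fst _ _ _
    have hz' : zeta hQ hP ≫ q = b' := hP.lift_snd _ _ _
    have hcz : c ≫ zeta hQ hP = 𝟙 P := hP.hom_ext (by simp [hz, hca]) (by simp [hz', hcb'])
    refine ⟨c, ?_, hcz⟩
    have ea : (zeta hQ hP ≫ c) ≫ a = a := by simp [hca, hz]
    have eb' : (zeta hQ hP ≫ c) ≫ b' = b' := by simp [hcb', hz']
    have et : ((zeta hQ hP ≫ c) ≫ a') ≫ k₀ = a' ≫ k₀ := by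
      apply hom_ext_of_isLimit hp
      · rw [Category.assoc _ a', hQ.eq_t]
        simp only [Category.assoc, ← hL.w]
        rw [← reassoc_of% hQ.eq_x, reassoc_of% hca, reassoc_of% hz]
      · simp only [Category.assoc, hK.w]
        rw [reassoc_of% hQ.eq_z, reassoc_of% hcb', reassoc_of% hz']
    have ea' : (zeta hQ hP ≫ c) ≫ a' = a' := by
      refine hK.hom_ext et ?_
      rw [Category.assoc _ a', hQ.eq_z, ← Category.assoc, eb']
    have eb : (zeta hQ hP ≫ c) ≫ b = b := by
      refine hL.hom_ext ?_ ?_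
      · rw [Category.assoc _ b, ← hQ.eq_x, ← Category.assoc, ea]
      · rw [Category.assoc _ b, ← hQ.eq_t, ← Category.assoc, ea']
    exact (hQ.existsUnique_lift a a' b b' hQ.eq_x hQ.eq_y hQ.eq_t hQ.eq_z).unique
      ⟨ea, ea', eb, eb'⟩ (by simp)

/-- Axiom `∗` for a product `X × X`, unwound for the kernel relation of a map `h`: the triples
`(α, β, γ)` of elements of `X × X` with `p₁ α = p₁ β` and `h β = h γ` are covered by the
quadruples in which, moreover, `δ` satisfies `p₁ δ = p₁ γ` and `h δ = h α`. -/
theorem AxiomStar.exists_cover [HasFiniteLimits D] [HasZeroMorphisms D] (hS : AxiomStar D)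
    {X Y W V : D} {p₀ : W ⟶ X} {p₁ : W ⟶ Y} (hp : IsLimit (BinaryFan.mk p₀ p₁)) (h : W ⟶ V) :
    ∃ (Q P : D) (ζ : Q ⟶ P) (α β γ : P ⟶ W) (δ : Q ⟶ W), ExtremalEpi ζ ∧
      (∀ ⦃A : D⦄ (a b c : A ⟶ W), a ≫ p₁ = b ≫ p₁ → b ≫ h = c ≫ h →
        ∃ l : A ⟶ P, l ≫ α = a ∧ l ≫ β = b ∧ l ≫ γ = c) ∧
      (∀ ⦃A : D⦄ (f g : A ⟶ Q), f ≫ ζ = g ≫ ζ → f ≫ δ = g ≫ δ → f = g) ∧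
      δ ≫ p₁ = ζ ≫ γ ≫ p₁ ∧ δ ≫ h = ζ ≫ α ≫ h := by
  have hK := IsKernelPair.of_hasPullback p₁
  have hT := IsKernelPair.of_hasPullback h
  set K := pullback p₁ p₁
  set k₀ : K ⟶ W := pullback.fst p₁ p₁
  set k₁ : K ⟶ W := pullback.snd p₁ p₁
  set T := pullback h h
  set t₀ : T ⟶ W := pullback.fst h h
  set t₁ : T ⟶ W := pullback.snd h h
  obtain ⟨Q, a, a', b, b', hQ⟩ := exists_isSquareObj k₀ k₁ t₀ t₁
  have hP := IsPullback.of_hasPullback k₁ t₀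
  set p := pullback.fst k₁ t₀
  set q := pullback.snd k₁ t₀
  have hz : zeta hQ hP ≫ p = a := hP.lift_fst _ _ _
  have hz' : zeta hQ hP ≫ q = b' := hP.lift_snd _ _ _
  have jm : JointlyMono₂ p₁ p₀ := ⟨fun _ _ _ h₁ h₀ => hom_ext_of_isLimit hp h₀ h₁⟩
  -- The section `(1, 0)` of `p₀` is killed by `p₁`, so the span is right punctual when read as
  -- `(p₁, p₀)`.
  obtain ⟨s, hs₀, hs₁⟩ := exists_lift_of_isLimit hp (𝟙 X) (0 : X ⟶ Y)
  refine ⟨Q, _, zeta hQ hP, p ≫ k₀, p ≫ k₁, q ≫ t₁, a' ≫ k₀,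
    hS p₁ p₀ t₀ t₁ k₀ k₁ jm ⟨s, hs₀, hs₁⟩ (isDifunctional_of_isLimit hp)
      (isEquivalenceRelation_of_isKernelPair hT) hK a a' b b' p q hQ hP, ?_, ?_, ?_, ?_⟩
  · intro A x y z hxy hyz
    refine ⟨hP.lift (hK.lift x y hxy) (hT.lift y z hyz) (by simp), ?_, ?_, ?_⟩ <;> simp
  · intro A f g hfg hδ
    have ea : f ≫ a = g ≫ a := by rw [← hz, reassoc_of% hfg]
    have eb' : f ≫ b' = g ≫ b' := by rw [← hz', reassoc_of% hfg]
    have ea' : f ≫ a' = g ≫ a' := by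
      refine hK.hom_ext (by simpa using hδ) ?_
      rw [Category.assoc, Category.assoc, hQ.eq_z, reassoc_of% eb']
    have eb : f ≫ b = g ≫ b := by
      refine hT.hom_ext ?_ ?_
      · rw [Category.assoc, Category.assoc, ← hQ.eq_x, reassoc_of% ea]
      · rw [Category.assoc, Category.assoc, ← hQ.eq_t, reassoc_of% ea']
    refine (hQ.existsUnique_lift (g ≫ a) (g ≫ a') (g ≫ b) (g ≫ b') ?_ ?_ ?_ ?_).unique
      ⟨ea, ea', eb, eb'⟩ (by simp)
    · simp [hQ.eq_x]
    · simp [hQ.eq_y]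
    · simp [hQ.eq_t]
    · simp [hQ.eq_z]
  · simp only [Category.assoc, hK.w]
    rw [reassoc_of% hQ.eq_z, reassoc_of% hz']
  · simp only [Category.assoc]
    rw [reassoc_of% hQ.eq_t, ← hT.w, ← reassoc_of% hQ.eq_x, reassoc_of% hz]

end Star

/-! ### Subobjects of abelian objects -/

namespace Pt

variable {C : Type u} [Category.{v} C] {Y : C}

theorem isAbelian_of_mono [HasPullbacks C] (hG : IsGumm C) (hS : AxiomStar (Pt Y))
    {U A : Pt Y} (m : U ⟶ A) [Mono m] (hA : IsAbelian A) : IsAbelian U := by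
  obtain ⟨s⟩ := hA
  have hp := prodIsProd U U
  obtain ⟨k, hk₀, hk₁⟩ := exists_lift_of_isLimit s.isProduct
    (prod.fst (X := U) (Y := U) ≫ m) (prod.snd ≫ m)
  have hself : ∀ ⦃B : Pt Y⦄ (u : B ⟶ U ⨯ U), u ≫ prod.fst = u ≫ prod.snd → u ≫ k ≫ s.d = 0 := by
    intro B u hu
    rw [← Category.assoc]
    apply s.d_self
    simp [hk₀, hk₁, reassoc_of% hu]
  have hzero : ∀ ⦃B : Pt Y⦄ (u : B ⟶ U ⨯ U), u ≫ prod.snd = 0 →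
      u ≫ k ≫ s.d = u ≫ prod.fst ≫ m := by
    intro B u hu
    rw [← Category.assoc, s.d_zero]
    · simp [hk₀]
    · simp [hk₁, reassoc_of% hu]
  obtain ⟨Q, P, ζ, α, β, γ, δ, hζ, hl, hQ, hδ₁, hδ⟩ := hS.exists_cover hp (k ≫ s.d)
  have hinj : ∀ ⦃B : Pt Y⦄ (x y : B ⟶ U ⨯ U), x ≫ prod.snd = y ≫ prod.snd →
      x ≫ k ≫ s.d = y ≫ k ≫ s.d → x = y := by
    intro B x y h₁ h
    refine hom_ext_of_isLimit hp ?_ h₁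
    -- Shift from `(a, b), (a', b)` to `(a, 0), (a', 0)`, where subtraction returns `m a` and `m
    -- a'`.
    have key : prod.lift (x ≫ prod.fst) 0 ≫ k ≫ s.d = prod.lift (y ≫ prod.fst) 0 ≫ k ≫ s.d := by
      apply hom_ext
      refine shift hG hp (k ≫ s.d) (x := x.hom) (x' := y.hom) ?_ ?_ (congrArg Hom.hom h₁) ?_
        (congrArg Hom.hom h)
      · rw [← comp_hom, ← comp_hom, prod.lift_fst]
      · rw [← comp_hom, ← comp_hom, prod.lift_fst]
      · rw [← comp_hom, ← comp_hom, prod.lift_snd, prod.lift_snd]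
    rw [hzero _ (prod.lift_snd _ _), hzero _ (prod.lift_snd _ _), prod.lift_fst_assoc,
      prod.lift_fst_assoc] at key
    exact (cancel_mono m).1 key
  have hmono : Mono ζ := ⟨fun f g hfg => hQ f g hfg (hinj _ _
    (by rw [Category.assoc, Category.assoc, hδ₁, reassoc_of% hfg])
    (by rw [Category.assoc, Category.assoc, hδ, reassoc_of% hfg]))⟩
  have hiso : IsIso ζ := ExtremalEpi.isIso ζ (𝟙 Q) ζ (Category.id_comp ζ)
  -- The triple `(x, y), (y, y), (0, 0)`: its completion is `(w, 0)` with `m w = d(m x, m y)`.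
  obtain ⟨l, hα, -, hγ⟩ := hl (𝟙 (U ⨯ U)) (prod.lift prod.snd prod.snd) 0
    (by rw [prod.lift_snd, Category.id_comp])
    (by rw [hself _ (by rw [prod.lift_fst, prod.lift_snd]), zero_comp])
  have hw₁ : (l ≫ inv ζ ≫ δ) ≫ prod.snd = 0 := by
    rw [Category.assoc, Category.assoc, hδ₁, IsIso.inv_hom_id_assoc, reassoc_of% hγ, zero_comp]
  have hw : (l ≫ inv ζ ≫ δ) ≫ prod.fst ≫ m = k ≫ s.d := by
    rw [← hzero _ hw₁, Category.assoc, Category.assoc, hδ, IsIso.inv_hom_id_assoc,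
      reassoc_of% hα]
  refine ⟨⟨U ⨯ U, prod.fst, prod.snd, hp, (l ≫ inv ζ ≫ δ) ≫ prod.fst, ?_, ?_⟩⟩
  · intro B u hu
    rw [← cancel_mono m, Category.assoc, Category.assoc _ prod.fst, hw, hself _ hu, zero_comp]
  · intro B u hu
    rw [← cancel_mono m, Category.assoc, Category.assoc _ prod.fst, hw, hzero _ hu,
      Category.assoc]

end Pt

/-! ### Diagonal punctuations in a pointed category -/

section Punctuation

variable {D : Type u} [Category.{v} D] [HasZeroObject D] [HasZeroMorphisms D] {X XX Dp : D}
  {p₀ p₁ : XX ⟶ X} {s₀ : X ⟶ XX} {ω : XX ⟶ Dp}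

namespace IsDiagonalPunctuation

theorem s₀_ω (h : IsDiagonalPunctuation p₀ p₁ s₀ ω) : s₀ ≫ ω = 0 := by
  rw [h.isPushout.w, zero_comp]

theorem exists_desc (h : IsDiagonalPunctuation p₀ p₁ s₀ ω) {Z : D} (k : XX ⟶ Z)
    (hk : s₀ ≫ k = 0) : ∃ l : Dp ⟶ Z, ω ≫ l = k :=
  ⟨h.isPushout.desc k 0 (by rw [hk, zero_comp]), h.isPushout.inl_desc _ _ _⟩

/-- If `ω` factors through a mono `i`, the first factor also kills the diagonal, hence extends along
`ω`; the extension splits `i`. -/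
theorem extremalEpi (h : IsDiagonalPunctuation p₀ p₁ s₀ ω) : ExtremalEpi ω where
  left_cancellation f g e := h.isPushout.hom_ext e (by rw [zero_comp, zero_comp])
  isIso p i fac _ := by
    obtain ⟨l, hl⟩ := h.exists_desc p (by
      rw [← cancel_mono i, Category.assoc, fac, h.s₀_ω, zero_comp])
    have hli : l ≫ i = 𝟙 Dp := h.isPushout.hom_ext (by rw [reassoc_of% hl, fac, Category.comp_id])
      (by rw [zero_comp, zero_comp])
    exact ⟨l, by rw [← cancel_mono i, Category.assoc, hli, Category.comp_id, Category.id_comp],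
      hli⟩

end IsDiagonalPunctuation

end Punctuation

theorem exists_desc_of_isRegularEpi {C : Type u} [Category.{v} C] {X Y Z : C} (q : X ⟶ Y)
    [IsRegularEpi q] (k : X ⟶ Z)
    (h : ∀ ⦃A : C⦄ (x y : A ⟶ X), x ≫ q = y ≫ q → x ≫ k = y ≫ k) : ∃ l : Y ⟶ Z, q ≫ l = k :=
  ⟨IsRegularEpi.desc q k (h _ _ (IsRegularEpi.w q)), IsRegularEpi.fac q k _⟩

/-! ### The diagonal punctuation over a regular base -/

namespace Pt

variable {C : Type u} [Category.{v} C] {Y : C}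

section Regular

variable [Regular C]

/-- The image of `f.hom` in `C` inherits a projection to `Y` and a section, so it is a subobject in
the fibre as well. -/
theorem isRegularEpi_hom_of_extremalEpi {P Q : Pt Y} (f : P ⟶ Q) [ExtremalEpi f] :
    IsRegularEpi f.hom := by
  let F := Regular.strongEpiMonoFactorisation f.hom
  have fac : F.e ≫ F.m = f.hom := F.fac
  let I : Pt Y := ⟨F.I, F.m ≫ Q.π, P.σ ≫ F.e, by
    rw [Category.assoc, reassoc_of% fac, hom_π, P.σ_π]⟩
  let e : P ⟶ I := ⟨F.e, by
    change F.e ≫ F.m ≫ Q.π = _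
    rw [reassoc_of% fac, hom_π], rfl⟩
  let m : I ⟶ Q := ⟨F.m, rfl, by
    change (P.σ ≫ F.e) ≫ F.m = _
    rw [Category.assoc, fac, σ_hom]⟩
  have : Mono m.hom := F.m_mono
  have : Mono m := mono_of_mono_hom m
  have : IsIso m := ExtremalEpi.isIso f e m (hom_ext fac)
  have : IsIso F.m := isIso_hom m
  have : StrongEpi F.e := F.e_strong_epi
  have : StrongEpi f.hom := fac ▸ strongEpi_comp F.e F.m
  infer_instance

theorem isPushout_hom {X XX Dp : Pt Y} {d₀ d₁ : XX ⟶ X} {s₀ : X ⟶ XX} {ω : XX ⟶ Dp}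
    (h : IsDiagonalPunctuation d₀ d₁ s₀ ω) : IsPushout s₀.hom X.π ω.hom Dp.σ := by
  have := h.extremalEpi
  have := isRegularEpi_hom_of_extremalEpi ω
  have key : ∀ s : PushoutCocone s₀.hom X.π,
      ∃ l : Dp.obj ⟶ s.pt, ω.hom ≫ l = s.inl ∧ Dp.σ ≫ l = s.inr := by
    intro s
    -- The cocone vertex need not lie over `Y`; multiplying it by `Y` brings the cocone into the
    -- fibre.
    let V : Pt Y := ⟨s.pt ⨯ Y, prod.snd, prod.lift s.inr (𝟙 Y), prod.lift_snd _ _⟩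
    let k : XX ⟶ V := ⟨prod.lift s.inl XX.π, prod.lift_snd _ _, by
      change XX.σ ≫ prod.lift s.inl XX.π = prod.lift s.inr (𝟙 Y)
      rw [prod.comp_lift, XX.σ_π, ← σ_hom s₀, Category.assoc, s.condition, X.σ_π_assoc]⟩
    obtain ⟨l, hl⟩ := h.exists_desc k (by
      apply hom_ext
      change s₀.hom ≫ prod.lift s.inl XX.π = X.π ≫ prod.lift s.inr (𝟙 Y)
      rw [prod.comp_lift, prod.comp_lift, s.condition, hom_π, Category.comp_id])
    refine ⟨l.hom ≫ (prod.fst : s.pt ⨯ Y ⟶ s.pt), ?_, ?_⟩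
    · rw [← Category.assoc, ← comp_hom, hl]
      exact prod.lift_fst _ _
    · rw [σ_hom_assoc]
      exact prod.lift_fst _ _
  choose l hl₀ hl₁ using key
  exact ⟨⟨congrArg Hom.hom h.s₀_ω⟩, ⟨PushoutCocone.IsColimit.mk _ l hl₀ hl₁
    (fun s m hm _ => by rw [← cancel_epi ω.hom, hm, hl₀])⟩⟩

/-- By Axiom `∗`, every element of the diagonal punctuation is locally of the form `ω(x, 0)`. -/
theorem isRegularEpi_inl_ω (hS : AxiomStar (Pt Y)) {X XX Dp : Pt Y} {d₀ d₁ : XX ⟶ X}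
    {s₀ : X ⟶ XX} {ω : XX ⟶ Dp} (h : IsDiagonalPunctuation d₀ d₁ s₀ ω) {j : X ⟶ XX}
    (hj₀ : j ≫ d₀ = 𝟙 X) (hj₁ : j ≫ d₁ = 0) : IsRegularEpi (j ≫ ω).hom := by
  obtain ⟨hp⟩ := h.isProduct
  obtain ⟨Q, P, ζ, α, β, γ, δ, hζ, hl, -, hδ₁, hδ⟩ := hS.exists_cover hp ω
  -- Again the triple `(x, y), (y, y), (0, 0)`, now completed only after pulling back along `ζ`.
  obtain ⟨l, hα, -, hγ⟩ := hl (𝟙 XX) (d₁ ≫ s₀) 0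
    (by rw [Category.assoc, h.s₀_p₁, Category.id_comp, Category.comp_id])
    (by rw [Category.assoc, h.s₀_ω, comp_zero, zero_comp])
  have := h.extremalEpi
  have := isRegularEpi_hom_of_extremalEpi ω
  have := isRegularEpi_hom_of_extremalEpi ζ
  obtain ⟨E, e, c, hE⟩ : ∃ (E : Pt Y) (e : E ⟶ XX) (c : E ⟶ Q), IsPullback e c l ζ :=
    ⟨_, _, _, IsPullback.of_hasPullback l ζ⟩
  have he : IsRegularEpi e.hom :=
    Regular.regularEpiIsStableUnderBaseChange.of_isPullback (isPullback_hom hE).flip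
      (inferInstanceAs (IsRegularEpi ζ.hom))
  have hcδ : c ≫ δ = (c ≫ δ ≫ d₀) ≫ j := by
    apply hom_ext_of_isLimit hp
    · simp only [Category.assoc, hj₀, Category.comp_id]
    · simp only [Category.assoc, hj₁, comp_zero, hδ₁]
      rw [← hE.w_assoc, reassoc_of% hγ, zero_comp, comp_zero]
  have key : (c ≫ δ ≫ d₀) ≫ j ≫ ω = e ≫ ω := by
    rw [← Category.assoc, ← hcδ, Category.assoc, hδ, ← hE.w_assoc, reassoc_of% hα]
  have key' : (c ≫ δ ≫ d₀).hom ≫ (j ≫ ω).hom = e.hom ≫ ω.hom := congrArg Hom.hom key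
  have : StrongEpi ((c ≫ δ ≫ d₀).hom ≫ (j ≫ ω).hom) := key' ▸ strongEpi_comp e.hom ω.hom
  have : StrongEpi (j ≫ ω).hom := strongEpi_of_strongEpi (c ≫ δ ≫ d₀).hom _
  infer_instance

theorem isRegularEpi_hom_prod {X XX Z ZZ : Pt Y} {d₀ d₁ : XX ⟶ X} {z₀ z₁ : ZZ ⟶ Z}
    (hX : IsLimit (BinaryFan.mk d₀ d₁)) (hZ : IsLimit (BinaryFan.mk z₀ z₁)) (η : X ⟶ Z)
    [IsRegularEpi η.hom] {q : XX ⟶ ZZ} (h₀ : q ≫ z₀ = d₀ ≫ η) (h₁ : q ≫ z₁ = d₁ ≫ η) :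
    IsRegularEpi q.hom := by
  have kX := isPullback_of_isLimit_binaryFan hX
  have kZ := isPullback_of_isLimit_binaryFan hZ
  have c₀ := pullback.condition (f := z₀.hom) (g := η.hom)
  set a := pullback.fst z₀.hom η.hom
  have c₁ := pullback.condition (f := a ≫ z₁.hom) (g := η.hom)
  set b := pullback.fst (a ≫ z₁.hom) η.hom
  set x := pullback.snd z₀.hom η.hom
  set y := pullback.snd (a ≫ z₁.hom) η.hom
  have hxy : (b ≫ x) ≫ X.π = y ≫ X.π := by
    rw [← hom_π η, ← reassoc_of% c₁, Category.assoc, ← reassoc_of% c₀, kZ.w]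
  -- Pulling `η` back along one coordinate and then the other covers `ZZ` by a composite that
  -- factors through `q`.
  have hq : kX.lift (b ≫ x) y hxy ≫ q.hom = b ≫ a := by
    apply kZ.hom_ext
    · rw [Category.assoc, ← comp_hom, h₀, comp_hom, kX.lift_fst_assoc, Category.assoc,
        Category.assoc, c₀]
    · rw [Category.assoc, ← comp_hom, h₁, comp_hom, kX.lift_snd_assoc, Category.assoc, c₁]
  have : StrongEpi (kX.lift (b ≫ x) y hxy ≫ q.hom) := hq ▸ strongEpi_comp b a
  have : StrongEpi q.hom := strongEpi_of_strongEpi (kX.lift (b ≫ x) y hxy) _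
  infer_instance

/-- The elements `ω(x, y)` only depend on `ω(x, 0)` and `ω(y, 0)`. -/
theorem comp_ω_eq (hG : IsGumm C) {X XX Dp : Pt Y} {d₀ d₁ : XX ⟶ X}
    {s₀ : X ⟶ XX} {ω : XX ⟶ Dp} (h : IsDiagonalPunctuation d₀ d₁ s₀ ω) {j : X ⟶ XX}
    (hj₀ : j ≫ d₀ = 𝟙 X) (hj₁ : j ≫ d₁ = 0) {A : C} (u v : A ⟶ XX.obj)
    (h₀ : (u ≫ d₀.hom) ≫ (j ≫ ω).hom = (v ≫ d₀.hom) ≫ (j ≫ ω).hom)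
    (h₁ : (u ≫ d₁.hom) ≫ (j ≫ ω).hom = (v ≫ d₁.hom) ≫ (j ≫ ω).hom) :
    u ≫ ω.hom = v ≫ ω.hom := by
  obtain ⟨hp⟩ := h.isProduct
  have kX := isPullback_of_isLimit_binaryFan hp
  have hp' : IsLimit (BinaryFan.mk d₁ d₀) := BinaryFan.isLimitFlip hp
  have j₀ : j.hom ≫ d₀.hom = 𝟙 _ := congrArg Hom.hom hj₀
  have j₁ : j.hom ≫ d₁.hom = X.π ≫ X.σ := congrArg Hom.hom hj₁
  have e₀ : s₀.hom ≫ d₀.hom = 𝟙 _ := congrArg Hom.hom h.s₀_p₀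
  have e₁ : s₀.hom ≫ d₁.hom = 𝟙 _ := congrArg Hom.hom h.s₀_p₁
  have eω : s₀.hom ≫ ω.hom = X.π ≫ Dp.σ := congrArg Hom.hom h.s₀_ω
  have hu : (u ≫ d₀.hom) ≫ X.π = (u ≫ d₁.hom) ≫ X.π := by
    rw [Category.assoc, Category.assoc, kX.w]
  have hv : (v ≫ d₀.hom) ≫ X.π = (v ≫ d₁.hom) ≫ X.π := by
    rw [Category.assoc, Category.assoc, kX.w]
  have huv : (u ≫ d₀.hom) ≫ X.π = (v ≫ d₀.hom) ≫ X.π := by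
    rw [← hom_π (j ≫ ω), ← Category.assoc, h₀, Category.assoc]
  generalize hx : u ≫ d₀.hom = x at *
  generalize hy : u ≫ d₁.hom = y at *
  generalize hx' : v ≫ d₀.hom = x' at *
  generalize hy' : v ≫ d₁.hom = y' at *
  have hx'y : x' ≫ X.π = y ≫ X.π := huv.symm.trans hu
  have hyy' : y ≫ X.π = y' ≫ X.π := hx'y.symm.trans hv
  rw [comp_hom, ← Category.assoc, ← Category.assoc] at h₀ h₁
  -- Shift `ω(x, 0) = ω(x', 0)` to `ω(x, y) = ω(x', y)`.
  have s₁ : u ≫ ω.hom = kX.lift x' y hx'y ≫ ω.hom := by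
    refine shift hG hp ω (x := x ≫ j.hom) (x' := x' ≫ j.hom) ?_ ?_ ?_ ?_ h₀
    · rw [Category.assoc, j₀, Category.comp_id, hx]
    · rw [Category.assoc, j₀, Category.comp_id, kX.lift_fst]
    · rw [Category.assoc, Category.assoc, j₁, reassoc_of% huv]
    · rw [kX.lift_snd, hy]
  -- Shift `ω(y, 0) = ω(y', 0)` to `ω(y, y') = ω(y', y') = 0`.
  have s₂ : kX.lift y y' hyy' ≫ ω.hom = (y' ≫ s₀.hom) ≫ ω.hom := by
    refine shift hG hp ω (x := y ≫ j.hom) (x' := y' ≫ j.hom) ?_ ?_ ?_ ?_ h₁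
    · rw [Category.assoc, j₀, Category.comp_id, kX.lift_fst]
    · rw [Category.assoc, Category.assoc, j₀, e₀]
    · rw [Category.assoc, Category.assoc, j₁, reassoc_of% hyy']
    · rw [kX.lift_snd, Category.assoc, e₁, Category.comp_id]
  -- With the coordinates exchanged, shift `ω(y, y) = 0 = ω(y, y')` to `ω(x', y) = ω(x', y')`.
  have s₃ : kX.lift x' y hx'y ≫ ω.hom = v ≫ ω.hom := by
    refine shift hG hp' ω (x := y ≫ s₀.hom) (x' := kX.lift y y' hyy') ?_ ?_ ?_ ?_ ?_
    · rw [Category.assoc, e₁, Category.comp_id, kX.lift_snd]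
    · rw [kX.lift_snd, hy']
    · rw [Category.assoc, e₀, Category.comp_id, kX.lift_fst]
    · rw [kX.lift_fst, hx']
    · rw [s₂, Category.assoc, Category.assoc, eω, reassoc_of% hyy']
  exact s₁.trans s₃

theorem isAbelian_of_isDiagonalPunctuation (hG : IsGumm C) (hS : AxiomStar (Pt Y))
    {X XX Dp : Pt Y} {d₀ d₁ : XX ⟶ X} {s₀ : X ⟶ XX} {ω : XX ⟶ Dp}
    (h : IsDiagonalPunctuation d₀ d₁ s₀ ω) : IsAbelian Dp := by
  obtain ⟨hp⟩ := h.isProduct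
  obtain ⟨j, hj₀, hj₁⟩ := exists_lift_of_isLimit hp (𝟙 X) 0
  have hη : IsRegularEpi (j ≫ ω).hom := isRegularEpi_inl_ω hS h hj₀ hj₁
  have hz := prodIsProd Dp Dp
  obtain ⟨q, hq₀, hq₁⟩ := exists_lift_of_isLimit hz (d₀ ≫ j ≫ ω) (d₁ ≫ j ≫ ω)
  have hq := isRegularEpi_hom_prod hp hz (j ≫ ω) hq₀ hq₁
  have q₀ : q.hom ≫ (prod.fst : Dp ⨯ Dp ⟶ Dp).hom = d₀.hom ≫ (j ≫ ω).hom := congrArg Hom.hom hq₀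
  have q₁ : q.hom ≫ (prod.snd : Dp ⨯ Dp ⟶ Dp).hom = d₁.hom ≫ (j ≫ ω).hom := congrArg Hom.hom hq₁
  -- The subtraction is determined by `d(η x, η y) = ω(x, y)`; its two laws are checked after
  -- composing with the epimorphism `η`.
  obtain ⟨d, hd⟩ := exists_desc_of_isRegularEpi q.hom ω.hom (fun A u v huv =>
    comp_ω_eq hG h hj₀ hj₁ u v
      (by rw [Category.assoc, Category.assoc, ← q₀, reassoc_of% huv])
      (by rw [Category.assoc, Category.assoc, ← q₁, reassoc_of% huv]))
  let d' : Dp ⨯ Dp ⟶ Dp := ⟨d, by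
    rw [← cancel_epi q.hom, reassoc_of% hd, hom_π, hom_π], by
    rw [← σ_hom q, Category.assoc, hd, σ_hom]⟩
  have hd' : q ≫ d' = ω := hom_ext hd
  have epi : ∀ {Z : Pt Y} (f g : Dp ⟶ Z), (j ≫ ω) ≫ f = (j ≫ ω) ≫ g → f = g :=
    fun f g e => hom_ext ((cancel_epi (j ≫ ω).hom).1 (congrArg Hom.hom e))
  have hdiag : prod.lift (𝟙 Dp) (𝟙 Dp) ≫ d' = 0 := by
    apply epi
    have : (j ≫ ω) ≫ prod.lift (𝟙 Dp) (𝟙 Dp) = s₀ ≫ q := by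
      apply hom_ext_of_isLimit hz
      · rw [Category.assoc, prod.lift_fst, Category.assoc s₀, hq₀, reassoc_of% h.s₀_p₀,
          Category.comp_id]
      · rw [Category.assoc, prod.lift_snd, Category.assoc s₀, hq₁, reassoc_of% h.s₀_p₁,
          Category.comp_id]
    rw [← Category.assoc, this, Category.assoc, hd', h.s₀_ω, comp_zero]
  have hinl : prod.lift (𝟙 Dp) 0 ≫ d' = 𝟙 Dp := by
    apply epi
    have : (j ≫ ω) ≫ prod.lift (𝟙 Dp) 0 = j ≫ q := by
      apply hom_ext_of_isLimit hz
      · rw [Category.assoc, prod.lift_fst, Category.assoc j q, hq₀, reassoc_of% hj₀,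
          Category.comp_id]
      · rw [Category.assoc, prod.lift_snd, Category.assoc j q, hq₁, reassoc_of% hj₁,
          comp_zero, zero_comp]
    rw [← Category.assoc, this, Category.assoc, hd', Category.comp_id]
  refine ⟨⟨Dp ⨯ Dp, prod.fst, prod.snd, hz, d', ?_, ?_⟩⟩
  · intro B u hu
    have : u = (u ≫ prod.fst) ≫ prod.lift (𝟙 Dp) (𝟙 Dp) := by
      apply hom_ext_of_isLimit hz
      · rw [Category.assoc _ (prod.lift _ _), prod.lift_fst, Category.comp_id]
      · rw [Category.assoc _ (prod.lift _ _), prod.lift_snd, Category.comp_id, hu]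
    rw [this, Category.assoc, hdiag, comp_zero]
  · intro B u hu
    have : u = (u ≫ prod.fst) ≫ prod.lift (𝟙 Dp) 0 := by
      apply hom_ext_of_isLimit hz
      · rw [Category.assoc _ (prod.lift _ _), prod.lift_fst, Category.comp_id]
      · rw [Category.assoc _ (prod.lift _ _), prod.lift_snd, comp_zero, hu]
    conv_lhs => rw [this, Category.assoc, hinl, Category.comp_id]

end Regular

/-! ### Universality among abelian objects -/

/-- Shift `d(a, b) = 0 = d(b, b)` to `d(a, 0) = d(b, 0)`, that is, `a = b`. -/
theorem eq_of_comp_d_eq_zero [HasPullbacks C] (hG : IsGumm C) {A B : Pt Y} (s : Subtraction A)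
    (u : B ⟶ s.XX) (hu : u ≫ s.d = 0) : u ≫ s.p₀ = u ≫ s.p₁ := by
  obtain ⟨w, hw₀, hw₁⟩ := exists_lift_of_isLimit s.isProduct (u ≫ s.p₁) (u ≫ s.p₁)
  obtain ⟨x, hx₀, hx₁⟩ := exists_lift_of_isLimit s.isProduct (u ≫ s.p₀) 0
  obtain ⟨y, hy₀, hy₁⟩ := exists_lift_of_isLimit s.isProduct (u ≫ s.p₁) 0
  rw [← hx₀, ← hy₀, ← s.d_zero x hx₁, ← s.d_zero y hy₁]
  exact hom_ext (shift hG s.isProduct s.d (x := u.hom) (x' := w.hom)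
    (congrArg Hom.hom hx₀.symm) (congrArg Hom.hom (hw₀.trans hy₀.symm))
    (congrArg Hom.hom hw₁.symm) (congrArg Hom.hom (hx₁.trans hy₁.symm))
    (congrArg Hom.hom (hu.trans (s.d_self w (hw₀.trans hw₁.symm)).symm)))

theorem existsUnique_desc_of_isAbelian [HasPullbacks C] (hG : IsGumm C)
    {X XX Dp : Pt Y} {d₀ d₁ : XX ⟶ X} {s₀ : X ⟶ XX} {ω : XX ⟶ Dp}
    (hω : IsDiagonalPunctuation d₀ d₁ s₀ ω) {ι : X ⟶ XX} (hι₀ : ι ≫ d₀ = 0)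
    (hι₁ : ι ≫ d₁ = 𝟙 X) {A : Pt Y} (hA : IsAbelian A) (h : X ⟶ A) :
    ∃! k : Dp ⟶ A, (ι ≫ ω) ≫ k = h := by
  obtain ⟨s⟩ := hA
  obtain ⟨hp⟩ := hω.isProduct
  have hp' : IsLimit (BinaryFan.mk d₁ d₀) := BinaryFan.isLimitFlip hp
  -- The arguments are swapped because the comparison is `y ↦ ω(0, y)`, and `d(h y, h 0) = h y`.
  obtain ⟨t, ht₀, ht₁⟩ := exists_lift_of_isLimit s.isProduct (d₁ ≫ h) (d₀ ≫ h)
  obtain ⟨k, hk⟩ := hω.exists_desc (t ≫ s.d) (by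
    rw [← Category.assoc]
    apply s.d_self
    rw [Category.assoc, Category.assoc, ht₀, ht₁, reassoc_of% hω.s₀_p₀, reassoc_of% hω.s₀_p₁])
  have hk' : (ι ≫ ω) ≫ k = h := by
    rw [Category.assoc, hk, ← Category.assoc, s.d_zero, Category.assoc, ht₀, reassoc_of% hι₁]
    rw [Category.assoc, ht₁, reassoc_of% hι₀, zero_comp]
  refine ⟨k, hk', fun l hl => ?_⟩
  obtain ⟨r, hr₀, hr₁⟩ := exists_lift_of_isLimit s.isProduct (ω ≫ l) (ω ≫ k)
  have hι : ι ≫ r ≫ s.d = 0 := by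
    rw [← Category.assoc]
    apply s.d_self
    rw [Category.assoc, Category.assoc, hr₀, hr₁, ← Category.assoc, ← Category.assoc, hl, hk']
  have hs : s₀ ≫ r ≫ s.d = 0 := by
    rw [← Category.assoc]
    apply s.d_self
    rw [Category.assoc, Category.assoc, hr₀, hr₁, reassoc_of% hω.s₀_ω, reassoc_of% hω.s₀_ω,
      zero_comp, zero_comp]
  -- The difference of `ω ≫ l` and `ω ≫ k` vanishes at `(0, y)` and `(0, x)`; shifting makes it
  -- equal at `(x, y)` and `(x, x)`, and it vanishes on the diagonal.
  have hr : 𝟙 XX ≫ r ≫ s.d = (d₀ ≫ s₀) ≫ r ≫ s.d := by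
    refine hom_ext (shift hG hp' (r ≫ s.d) (x := (d₁ ≫ ι).hom) (x' := (d₀ ≫ ι).hom)
      (y := Hom.hom (𝟙 XX)) (y' := (d₀ ≫ s₀).hom) ?_ ?_ ?_ ?_ ?_)
    · refine congrArg Hom.hom (?_ : (d₁ ≫ ι) ≫ d₁ = 𝟙 XX ≫ d₁)
      rw [Category.assoc, hι₁, Category.comp_id, Category.id_comp]
    · refine congrArg Hom.hom (?_ : (d₀ ≫ ι) ≫ d₁ = (d₀ ≫ s₀) ≫ d₁)
      rw [Category.assoc, Category.assoc, hι₁, hω.s₀_p₁]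
    · refine congrArg Hom.hom (?_ : (d₁ ≫ ι) ≫ d₀ = (d₀ ≫ ι) ≫ d₀)
      rw [Category.assoc, Category.assoc, hι₀, comp_zero, comp_zero]
    · refine congrArg Hom.hom (?_ : 𝟙 XX ≫ d₀ = (d₀ ≫ s₀) ≫ d₀)
      rw [Category.assoc, hω.s₀_p₀, Category.comp_id, Category.id_comp]
    · refine congrArg Hom.hom (?_ : (d₁ ≫ ι) ≫ r ≫ s.d = (d₀ ≫ ι) ≫ r ≫ s.d)
      rw [Category.assoc, Category.assoc, hι, comp_zero, comp_zero]
  rw [Category.id_comp, Category.assoc, hs, comp_zero] at hr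
  have hlk : ω ≫ l = ω ≫ k := by rw [← hr₀, ← hr₁, eq_of_comp_d_eq_zero hG s r hr]
  have := hω.extremalEpi
  exact (cancel_epi ω).1 hlk

end Pt

end GummCat

theorem mainTheorem2 {C : Type*} [Category* C] [Regular C]
    (hGumm : GummCat.IsGumm C)
    (hStar : ∀ Y : C, GummCat.AxiomStar (GummCat.Pt Y))
    (hDp : ∀ Y : C, GummCat.HasDiagonalPunctuations (GummCat.Pt Y)) :
    (∀ (Y : C) (X XX Dp : GummCat.Pt Y) (d₀ d₁ : XX ⟶ X) (s₀ : X ⟶ XX) (ω : XX ⟶ Dp),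
      GummCat.IsDiagonalPunctuation d₀ d₁ s₀ ω →
        -- the underlying square in `C`: `R[f]` is the kernel pair of `f`, and the square is the
        -- pushout of `s₀` along `f`, with `ω` a regular epimorphism
        IsKernelPair X.π d₀.hom d₁.hom ∧
        IsPushout s₀.hom X.π ω.hom Dp.σ ∧
        IsRegularEpi ω.hom ∧
        -- `Dp = (ψ, θ)` is the universal abelian split epimorphism associated with `X = (f, s)`,
        -- the universal comparison being `ω.(s.f, 1)`
        ∃ ι : X ⟶ XX, ι ≫ d₀ = 0 ∧ ι ≫ d₁ = 𝟙 X ∧ GummCat.IsUniversalAbelian (ι ≫ ω)) ∧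
    (∀ (Y : C) (U A : GummCat.Pt Y) (m : U ⟶ A), Mono m →
      GummCat.IsAbelian A → GummCat.IsAbelian U) := by
  refine ⟨fun Y X XX Dp d₀ d₁ s₀ ω h => ?_, fun Y U A m _ hA =>
    GummCat.Pt.isAbelian_of_mono hGumm (hStar Y) m hA⟩
  have := h.extremalEpi
  obtain ⟨hp⟩ := h.isProduct
  obtain ⟨ι, hι₀, hι₁⟩ := GummCat.exists_lift_of_isLimit hp 0 (𝟙 X)
  exact ⟨GummCat.Pt.isPullback_of_isLimit_binaryFan hp, GummCat.Pt.isPushout_hom h,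
    GummCat.Pt.isRegularEpi_hom_of_extremalEpi ω, ι, hι₀, hι₁,
    GummCat.Pt.isAbelian_of_isDiagonalPunctuation hGumm (hStar Y) h,
    fun _ hA f => GummCat.Pt.existsUnique_desc_of_isAbelian hGumm h hι₀ hι₁ hA f⟩
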